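/- For commutative groups $A,B$, a map $f:A\to B$ and $a\in A$ put $(\Delta_a f)(x)=f(x+a)-f(x)$. The functional degree $\operatorname{fdeg}(f)\in\mathbb N\cup\{-\infty,\infty\}$ is $-\infty$ if $f=0$; otherwise it is the least $n\in\mathbb N$ such that $\Delta_{a_1}\cdots\Delta_{a_{n+1}}f=0$ for all $a_1,\dots,a_{n+1}\in A$, or $\infty$ if there is no such $n$. Let $$\delta^\circ(A,B)=\sup\{\operatorname{fdeg}(f)\mid f:A\to B,\ \operatorname{fdeg}(f)<\infty\}\in\mathbb N\cup\{-\infty,\infty\}.$$ For a prime $p$ let $A[p^\infty]=\{x\in A\mid p^kx=0\text{ for some }k\ge 1\}$. A group has finite exponent if $nA=0$ for some integer $n\ge1$; the least such $n$ is its exponent. **Theorem.** Let $A$ and $B$ be nontrivial commutative torsion groups such that $A[p^\infty]$ has finite exponent for every prime $p$. a) $\delta^\circ(A,B)=\sup_p\delta^\circ(A[p^\infty],B[p^\infty])$, the supremum being over all primes $p$. b) If $A[p^\infty]$ and $B[p^\infty]$ are both nonzero for infinitely many primes $p$, then $\delta^\circ(A,B)=\infty$. c) If there is a prime $p$ such that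 $A[p^\infty]\ne0$ and $B[p^\infty]$ does not have finite exponent, then $\delta^\circ(A,B)=\infty$. d) If there is a prime $p$ such that $A[p^\infty]$ is infinite and $B[p^\infty]\neq0$, then $\delta^\circ(A,B)=\infty$. e) In the remaining case, that is, if the set $S$ of primes $p$ such that $A[p^\infty]$ and $B[p^\infty]$ are both nonzero is finite, and for each $p\in S$ the group $A[p^\infty]$ is finite and $B[p^\infty]$ has finite exponent, $\delta^\circ(A,B)$ is finite and is given as follows. For each $p\in S$ there are an integer $r_p\geq 1$ and integers $\alpha_{p,1}\ge\dots\ge\alpha_{p,r_p}\ge 0$ and $\beta_p\ge 0$ such that $$A[p^\infty]\cong\bigoplus_{j=1}^{r_p}\mathbb Z/p^{\alpha_{p,j}}\mathbb Z\quad\text{and}\quad B[p^\infty]\text{ has exponent }p^{\beta_p};$$ and for every such choice $$\delta^\circ(A[p^\infty],B[p^\infty])=d_p:=\sum_{j=1}^{r_p}(p^{\alpha_{p,j}}-1)+(\beta_p-1)(p-1)p^{\alpha_{p,1}-1}\quad(p\in S),$$ and $\delta^\circ(A,B)=\max_{p\in S}d_p$, where the maximum is $0$ if $S=\emptyset$.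 -/

import Mathlib

/-- For commutative groups `A`, `B` and `f : A → B`, this says that
`Δ_{a₁} ⋯ Δ_{aₙ₊₁} f = 0` for all `a₁, …, aₙ₊₁ ∈ A`, where `(Δ_a f)(x) = f (x + a) - f x`. -/
def FdegLE {A B : Type*} [AddCommGroup A] [AddCommGroup B] (f : A → B) (n : ℕ) : Prop :=
  ∀ a : Fin (n + 1) → A, (List.ofFn a).foldr fwdDiff f = 0

/-- The functional degree: `-∞` for the zero function, otherwise the least `n : ℕ` such that all
`(n + 1)`-fold differences of `f` vanish, and `∞` if there is no such `n`.  The set of values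
`ℕ ∪ {-∞, ∞}` is `WithBot ℕ∞`. -/
noncomputable def fdeg {A B : Type*} [AddCommGroup A] [AddCommGroup B] (f : A → B) :
    WithBot ℕ∞ :=
  open Classical in
  if f = 0 then ⊥ else ((sInf {m : ℕ∞ | ∃ n : ℕ, m = n ∧ FdegLE f n} : ℕ∞) : WithBot ℕ∞)

/-- `δ°(A, B)`, the supremum in `ℕ ∪ {-∞, ∞}` of the functional degrees of those maps `A → B`
that have functional degree less than `∞`. -/
noncomputable def deltaCirc (A B : Type*) [AddCommGroup A] [AddCommGroup B] : WithBot ℕ∞ :=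
  sSup {d : WithBot ℕ∞ | ∃ f : A → B, fdeg f = d ∧ fdeg f < ⊤}

/-- `A ≅ ⨁ⱼ ℤ/p^{αⱼ}ℤ` with `α₁ ≥ ⋯ ≥ α_{r+1}` (written `α 0, …, α r`), and `B` has finite
exponent `p^β`. -/
structure HasPrimaryType (A B : Type*) [AddCommGroup A] [AddCommGroup B] (p : ℕ) (r : ℕ)
    (α : Fin (r + 1) → ℕ) (β : ℕ) : Prop where
  antitone : Antitone α
  iso : Nonempty (A ≃+ ((j : Fin (r + 1)) → ZMod (p ^ α j)))
  exponent_eq : AddMonoid.exponent B = p ^ β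

/-- The number `∑ⱼ (p^{αⱼ} - 1) + (β - 1)(p - 1) p^{α₁ - 1}`, where `α₁` is `α 0`.  It is used for
`p ≥ 2`, `β ≥ 1` and `α 0 ≥ 1` only, so that no subtraction truncates. -/
def primaryDegree (p : ℕ) (r : ℕ) (α : Fin (r + 1) → ℕ) (β : ℕ) : ℕ :=
  ∑ j, (p ^ α j - 1) + (β - 1) * (p - 1) * p ^ (α 0 - 1)

/-! The group ring `ℤ[A]` acts on maps `A → B` by translations, and `[a] - 1` acts as `Δ_a`. Hence
`f` has degree at most `n` iff every product of `n + 1` elements `[a] - 1` kills `f`.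

For `A = ∏ ℤ/p^{α_j}` and `p^β B = 0`, put `x_j = [e_j] - 1`, so `(1 + x_j)^{p^{α_j}} = 1`. For `α_j
≥ 1` a first factor `p` appears in `x_j^{p^{α_j}}` and one more with every further `(p-1)p^{α_j-1}`
degrees; `pow_dvd_prod_pow` adds this up over `j` and gives the upper bound `d_p`. The bound is
attained: modulo `p^β` a suitable monomial of degree `d_p` is `±p^{β-1} ∑ [a]`
(`pow_dvd_top_monomial_sub_sum`), and `∑ [a]` turns the map supported at `0` with value `b` into the
constant `b`. If `b` has order `p^β`, the result is not zero.

For torsion groups, a map of finite degree into a `p`-group ignores translations of order prime to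
`p` (`FdegLE.apply_add_eq`), so the `p`-part of `f` factors through `A[p^∞]`. The infinite cases
follow from quotients `𝔽_p^{r+1}` of `A[p^∞]` and elements of order `p^β` in `B[p^∞]`: they give
degree `(r + β)(p - 1)`, where `p`, `β` or `r` is unbounded (`mul_le_deltaCirc`). -/

/-! ### Divisibility of powers of `x` when `1 + x` is a `p`-power root of unity -/

open Polynomial in
theorem geom_sum_one_add_X_eq (p n : ℕ) (hp : p.Prime) :
    ∃ r : ℤ[X], ∑ k ∈ Finset.range (p ^ n), (1 + X : ℤ[X]) ^ k = X ^ (p ^ n - 1) + (p : ℤ[X]) * r := by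
  obtain ⟨r, hr⟩ := exists_add_pow_prime_pow_eq hp (1 : ℤ[X]) X n
  -- Cancelling `X` is the reason for working in `ℤ[X]`; in a general ring `x` may be a zero
  -- divisor.
  refine ⟨r, mul_left_cancel₀ X_ne_zero ?_⟩
  have h := geom_sum_mul (1 + X : ℤ[X]) (p ^ n)
  rw [hr, add_sub_cancel_left] at h
  have h2 : (X : ℤ[X]) * X ^ (p ^ n - 1) = X ^ (p ^ n) :=
    mul_pow_sub_one (pow_ne_zero _ hp.ne_zero) _
  rw [mul_add, h2]
  linear_combination h

/-- In a commutative ring, the geometric sum of `1 + x` of length `p ^ n` is `x ^ (p ^ n - 1)`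
modulo `p`. -/
theorem exists_geom_sum_one_add_eq {R : Type*} [CommRing R] {p : ℕ} (hp : p.Prime) (n : ℕ)
    (x : R) : ∃ r : R, ∑ k ∈ Finset.range (p ^ n), (1 + x) ^ k = x ^ (p ^ n - 1) + p * r := by
  obtain ⟨r, hr⟩ := geom_sum_one_add_X_eq p n hp
  exact ⟨Polynomial.aeval x r, by simpa using congrArg (Polynomial.aeval x) hr⟩

/-- The geometric sum of `1 + x` of prime length `p` is `x ^ (p - 1) + p` modulo `p * x`. -/
theorem exists_geom_sum_prime_eq {R : Type*} [CommRing R] {p : ℕ} (hp : p.Prime) (x : R) :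
    ∃ r : R, ∑ k ∈ Finset.range p, (1 + x) ^ k = x ^ (p - 1) + p * (1 + x * r) := by
  obtain ⟨r, hr⟩ := geom_sum_one_add_X_eq p 1 hp
  rw [pow_one] at hr
  -- At `0` the geometric sum is `p`, so `r(0) = 1` and `X ∣ r - 1`.
  have h0 : (r - 1).eval 0 = 0 := by
    have h := congrArg (Polynomial.eval 0) hr
    have : p - 1 ≠ 0 := by have := hp.two_le; omega
    simp [Polynomial.eval_finsetSum, this] at h
    have hp0 : (p : ℤ) ≠ 0 := by exact_mod_cast hp.ne_zero
    have h1 : r.eval 0 = 1 := by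
      apply mul_left_cancel₀ hp0
      linarith
    simp [h1]
  obtain ⟨s, hs⟩ : Polynomial.X ∣ r - 1 := by
    rwa [Polynomial.X_dvd_iff, Polynomial.coeff_zero_eq_eval_zero]
  rw [eq_add_of_sub_eq' hs] at hr
  exact ⟨Polynomial.aeval x s, by simpa using congrArg (Polynomial.aeval x) hr⟩

/-- If `1 + x` has multiplicative order dividing `p ^ (a + 1)`, then high powers of `x` are
divisible by prescribed powers of `p`. -/
theorem pow_dvd_pow_of_one_add_pow_eq_one {R : Type*} [CommRing R] {p : ℕ} (hp : p.Prime) (a : ℕ)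
    {x : R} (hx : (1 + x) ^ p ^ (a + 1) = 1) (i : ℕ) :
    (p : R) ^ (i + 1) ∣ x ^ (p ^ (a + 1) + i * ((p - 1) * p ^ a)) := by
  obtain ⟨h, hh⟩ := exists_add_pow_prime_pow_eq hp (1 : R) x a
  set y := x ^ p ^ a with hy
  set u := y + p * (x * h) with hu
  have h1u : (1 + x) ^ p ^ a = 1 + u := by rw [hh, hu]; ring
  have hup : (1 + u) ^ p = 1 := by rw [← h1u, ← pow_mul, ← pow_succ, hx]
  obtain ⟨k, hk⟩ := exists_add_pow_prime_eq hp (1 : R) u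
  obtain ⟨s, hs⟩ := exists_add_pow_prime_eq hp u (-(p * (x * h)))
  obtain ⟨q, rfl⟩ : ∃ q, p = q + 2 := ⟨p - 2, by have := hp.two_le; omega⟩
  -- Expanding `(1 + u)^p = 1` shows `u^p ∈ p u R`; this passes to `y = u - p x h` with an error in
  -- `p² R`.
  have hyp : ∃ w t, y ^ (q + 2) = ((q + 2 : ℕ) : R) * (y * w + ((q + 2 : ℕ) : R) * t) := by
    have e1 : u ^ (q + 2) = - (((q + 2 : ℕ) : R) * u * k) := by
      rw [hup] at hk; linear_combination -hk
    have e2 : y = u + -(((q + 2 : ℕ) : R) * (x * h)) := by rw [hu]; ring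
    have e3 : (-(((q + 2 : ℕ) : R) * (x * h))) ^ (q + 2)
        = ((q + 2 : ℕ) : R) * (((q + 2 : ℕ) : R) * (((q + 2 : ℕ) : R) ^ q * (-(x * h)) ^ (q + 2))) := by
      rw [← mul_neg, mul_pow]; ring
    refine ⟨-k, -(x * h * k) + (((q + 2 : ℕ) : R) ^ q * (-(x * h)) ^ (q + 2)) - u * (x * h) * s, ?_⟩
    have e4 := hs
    rw [← e2, e1, e3] at e4
    rw [e4, hu]
    ring
  obtain ⟨w, t, hwt⟩ := hyp
  -- Each further `p - 1` powers of `y` gain one factor `p`. With `m = i + 1` the exponent of `x` is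
  -- `p^a (1 + (i+1)(p-1)) = p^{a+1} + i(p-1)p^a`.
  have key : ∀ m : ℕ, ∃ c d : R,
      y ^ (1 + m * (q + 1)) = ((q + 2 : ℕ) : R) ^ m * (y * c + ((q + 2 : ℕ) : R) * d) := by
    intro m
    induction m with
    | zero => exact ⟨1, 0, by simp⟩
    | succ m ih =>
      obtain ⟨c, d, hcd⟩ := ih
      refine ⟨w * c + d * y ^ q, t * c, ?_⟩
      have : y ^ (1 + (m + 1) * (q + 1)) = y ^ (1 + m * (q + 1)) * y ^ (q + 1) := by
        rw [← pow_add]; ring_nf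
      rw [this, hcd]
      have : ((q + 2 : ℕ) : R) ^ m * (y * c + ((q + 2 : ℕ) : R) * d) * y ^ (q + 1)
        = ((q + 2 : ℕ) : R) ^ m * (y ^ (q + 2) * c + ((q + 2 : ℕ) : R) * d * y ^ (q + 1)) := by ring
      rw [this, hwt]
      ring
  obtain ⟨c, d, hcd⟩ := key (i + 1)
  refine ⟨y * c + ((q + 2 : ℕ) : R) * d, ?_⟩
  rw [← hcd, hy, ← pow_mul]
  congr 1
  simp only [show q + 2 - 1 = q + 1 by omega]
  ring

/-- If `1 + x` has multiplicative order dividing `p ^ (a + 1)`, then the powers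
`x ^ (p ^ (a + 1) - 1 + i * (p - 1) * p ^ a)` are known up to one more power of `p`. -/
theorem pow_dvd_pow_sub_neg_pow_mul {R : Type*} [CommRing R] {p : ℕ} (hp : p.Prime) (a : ℕ)
    {x : R} (hx : (1 + x) ^ p ^ (a + 1) = 1) (i : ℕ) :
    (p : R) ^ (i + 1) ∣ x ^ (p ^ (a + 1) - 1 + i * ((p - 1) * p ^ a))
      - (-(p : R)) ^ i * x ^ (p ^ (a + 1) - 1) := by
  have up := pow_dvd_pow_of_one_add_pow_eq_one hp a hx
  obtain ⟨h, hh⟩ := exists_add_pow_prime_pow_eq hp (1 : R) x a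
  set y := x ^ p ^ a with hy
  set u := y + p * (x * h) with hu
  have h1u : (1 + x) ^ p ^ a = 1 + u := by rw [hh, hu]; ring
  have hup : (1 + u) ^ p = 1 := by rw [← h1u, ← pow_mul, ← pow_succ, hx]
  set Q := p ^ a with hQ
  have hQ1 : 0 < Q := Nat.one_le_pow _ _ hp.pos
  obtain ⟨Q', hQ'⟩ : ∃ Q', Q = Q' + 1 := ⟨Q - 1, by omega⟩
  obtain ⟨q, hq⟩ : ∃ q, p = q + 2 := ⟨p - 2, by have := hp.two_le; omega⟩
  have hp1 : p - 1 = q + 1 := by omega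
  have hpa : p ^ (a + 1) = Q * (q + 2) := by rw [pow_succ, ← hq]
  rw [hpa, hp1] at up ⊢
  obtain ⟨k, hk⟩ := exists_geom_sum_prime_eq hp u
  set Φ := ∑ k ∈ Finset.range p, (1 + u) ^ k with hΦ
  have huΦ : u * Φ = 0 := by
    have := geom_sum_mul (1 + u) p
    rw [hup, sub_self, ← hΦ, add_sub_cancel_left] at this
    rw [mul_comm, this]
  have hxu : u = x * (x ^ Q' + p * h) := by rw [hu, hy, hQ', pow_succ]; ring
  -- Both `u` and `u - y` are multiples of `x`, so replacing `u^{p-1}` by `y^{p-1}` leaves the error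
  -- in `p x R`.
  obtain ⟨g, hg⟩ : ∃ g, Φ = x ^ (Q * (q + 1)) + p * (1 + x * g) := by
    obtain ⟨v, hv⟩ := sub_dvd_pow_sub_pow u y (q + 1)
    refine ⟨h * v + (x ^ Q' + p * h) * k, ?_⟩
    have : u - y = p * (x * h) := by rw [hu]; ring
    rw [this] at hv
    rw [hk, hp1, pow_mul, ← hy]
    nth_rw 2 [hxu]
    linear_combination hv
  have hdvd : ∀ n i, Q * (q + 2) + i * ((q + 1) * Q) ≤ n → (p : R) ^ (i + 1) ∣ x ^ n :=
    fun n i hn => (up i).trans (pow_dvd_pow x hn)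
  -- Split off a factor `y = u - p x h`: as `u Φ = 0`, only the multiple of `p` survives, and the
  -- rest of the power of `x` supplies the other factors `p`.
  have killΦ : ∀ i, (p : R) ^ (i + 2) ∣ x ^ (Q * (q + 2) - 1 + i * ((q + 1) * Q)) * Φ := by
    intro i
    have e1 : Q * (q + 2) - 1 + i * ((q + 1) * Q)
        = (i + 1) * ((q + 1) * Q) - 1 + Q := by
      have : 0 < (i + 1) * ((q + 1) * Q) := by positivity
      have : Q * (q + 2) + i * ((q + 1) * Q) = (i + 1) * ((q + 1) * Q) + Q := by ring
      have : 0 < Q * (q + 2) := by positivity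
      omega
    have e2 : x ^ ((i + 1) * ((q + 1) * Q) - 1) * x = x ^ ((i + 1) * ((q + 1) * Q)) := by
      rw [← pow_succ]; congr 1
      exact Nat.sub_add_cancel (Nat.succ_le_of_lt (by positivity))
    have e3 : x ^ (Q * (q + 2) - 1 + i * ((q + 1) * Q)) * Φ
        = -(p * h) * x ^ ((i + 2) * ((q + 1) * Q))
          + -(p ^ 2 * h * (1 + x * g)) * x ^ ((i + 1) * ((q + 1) * Q)) := by
      rw [e1, pow_add, ← hy]
      have : y = u - p * (x * h) := by rw [hu]; ring
      rw [this]
      have e5 : x ^ ((i + 2) * ((q + 1) * Q))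
        = x ^ ((i + 1) * ((q + 1) * Q)) * x ^ (Q * (q + 1)) := by rw [← pow_add]; ring_nf
      rw [e5]
      have e6 : x ^ ((i + 1) * ((q + 1) * Q) - 1) * (u - p * (x * h)) * Φ
        = x ^ ((i + 1) * ((q + 1) * Q) - 1) * (u * Φ)
          - p * h * (x ^ ((i + 1) * ((q + 1) * Q) - 1) * x) * Φ := by ring
      rw [e6, huΦ, e2, hg]
      ring
    rw [e3]
    refine dvd_add ?_ ?_
    · rw [neg_mul, dvd_neg, pow_succ' _ (i + 1), mul_assoc]
      refine mul_dvd_mul_left _ (Dvd.dvd.mul_left (hdvd _ _ ?_) _)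
      nlinarith
    · rw [neg_mul, dvd_neg, add_comm i 2, pow_add, mul_assoc, mul_assoc]
      refine mul_dvd_mul_left _ (Dvd.dvd.mul_left (Dvd.dvd.mul_left ?_ _) _)
      cases i with
      | zero => simp
      | succ i =>
        refine hdvd _ _ ?_
        nlinarith
  induction i with
  | zero => simp
  | succ i ih =>
    have e1 : x ^ (Q * (q + 2) - 1 + (i + 1) * ((q + 1) * Q))
        = x ^ (Q * (q + 2) - 1 + i * ((q + 1) * Q)) * x ^ (Q * (q + 1)) := by
      rw [← pow_add]; ring_nf
    have e2 : x ^ (Q * (q + 2) - 1 + i * ((q + 1) * Q)) * x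
        = x ^ (Q * (q + 2) + i * ((q + 1) * Q)) := by
      rw [← pow_succ]; congr 1
      have : 0 < Q * (q + 2) := by positivity
      omega
    -- Substituting `x^{Q(p-1)} = Φ - p - p x g` shows that the next power is `-p` times the current
    -- one modulo `p^{i+2}`.
    have e3 : x ^ (Q * (q + 2) - 1 + (i + 1) * ((q + 1) * Q))
        - (-(p : R)) ^ (i + 1) * x ^ (Q * (q + 2) - 1)
        = x ^ (Q * (q + 2) - 1 + i * ((q + 1) * Q)) * Φ
          - p * x ^ (Q * (q + 2) + i * ((q + 1) * Q)) * g
          - p * (x ^ (Q * (q + 2) - 1 + i * ((q + 1) * Q))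
            - (-(p : R)) ^ i * x ^ (Q * (q + 2) - 1)) := by
      rw [e1, ← e2, hg]; ring
    rw [e3]
    refine dvd_sub (dvd_sub (killΦ i) (Dvd.dvd.mul_right ?_ _)) ?_
    · rw [pow_succ']; exact mul_dvd_mul_left _ (up i)
    · rw [pow_succ']; exact mul_dvd_mul_left _ ih

/-- After `p^a - 1` free degrees, a factor `p` costs at most `(p-1)p^b` degrees. A price independent
of `a ≤ b + 1` allows summation over several variables. -/
theorem exists_pow_dvd_pow_and_le {R : Type*} [CommRing R] {p : ℕ} (hp : p.Prime) {a b : ℕ}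
    (hab : a ≤ b + 1) {x : R} (hx : (1 + x) ^ p ^ a = 1) (m : ℕ) :
    ∃ v, (p : R) ^ v ∣ x ^ m ∧ m ≤ (p ^ a - 1) + v * ((p - 1) * p ^ b) := by
  have hp1 : 0 < p - 1 := by have := hp.two_le; omega
  have hpb : 0 < p ^ b := pow_pos hp.pos _
  rcases lt_or_ge m (p ^ a) with hm | hm
  · exact ⟨0, by simp, by omega⟩
  obtain ⟨t, rfl⟩ := Nat.exists_eq_add_of_le hm
  rcases a with _ | a
  · have hx0 : x = 0 := by simpa using hx
    refine ⟨1 + t, by simp [hx0], ?_⟩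
    have : 0 < (p - 1) * p ^ b := by positivity
    simp only [pow_zero]
    nlinarith
  · have hs : 0 < (p - 1) * p ^ a := by have := pow_pos hp.pos a; positivity
    refine ⟨t / ((p - 1) * p ^ a) + 1,
      (pow_dvd_pow_of_one_add_pow_eq_one hp a hx _).trans (pow_dvd_pow x ?_), ?_⟩
    · have := Nat.div_mul_le_self t ((p - 1) * p ^ a)
      omega
    · have h1 : t < (t / ((p - 1) * p ^ a) + 1) * ((p - 1) * p ^ a) :=
        (Nat.div_lt_iff_lt_mul hs).1 (Nat.lt_succ_self _)
      have h2 : (p - 1) * p ^ a ≤ (p - 1) * p ^ b :=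
        Nat.mul_le_mul_left _ (Nat.pow_le_pow_right hp.pos (by omega))
      have h3 := Nat.mul_le_mul_left (t / ((p - 1) * p ^ a) + 1) h2
      have : 0 < p ^ (a + 1) := pow_pos hp.pos _
      omega

open Finset in
/-- A monomial of large total degree in elements `x j` such that `(1 + x j) ^ p ^ α j = 1` is
divisible by `p ^ β`. -/
theorem pow_dvd_prod_pow {R ι : Type*} [CommRing R] [Fintype ι] {p : ℕ} (hp : p.Prime) {α : ι → ℕ}
    {b : ℕ} (hα : ∀ j, α j ≤ b + 1) {x : ι → R} (hx : ∀ j, (1 + x j) ^ p ^ α j = 1) {β : ℕ}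
    {m : ι → ℕ} (hm : ∑ j, (p ^ α j - 1) + (β - 1) * ((p - 1) * p ^ b) < ∑ j, m j) :
    (p : R) ^ β ∣ ∏ j, x j ^ m j := by
  choose v hv hmv using fun j => exists_pow_dvd_pow_and_le hp (hα j) (hx j) (m j)
  have h1 : (p : R) ^ ∑ j, v j ∣ ∏ j, x j ^ m j := by
    rw [← prod_pow_eq_pow_sum]
    exact prod_dvd_prod_of_dvd _ _ fun j _ => hv j
  refine (pow_dvd_pow _ ?_).trans h1
  -- With fewer than `β` factors `p` in total, the summed price bounds would contradict `hm`.
  by_contra! hlt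
  have h2 : ∑ j, m j ≤ ∑ j, (p ^ α j - 1) + (∑ j, v j) * ((p - 1) * p ^ b) := by
    rw [sum_mul, ← sum_add_distrib]
    exact sum_le_sum fun j _ => hmv j
  have h3 : (∑ j, v j) * ((p - 1) * p ^ b) ≤ (β - 1) * ((p - 1) * p ^ b) :=
    Nat.mul_le_mul_right _ (by omega)
  omega

/-! ### The augmentation ideal of a product of cyclic `p`-groups -/

section PiZMod

variable {R ι : Type*} [CommRing R] [DecidableEq ι] {q : ι → ℕ}

theorem map_single_pow_eq_one (φ : Multiplicative ((j : ι) → ZMod (q j)) →* R) (j : ι) :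
    (1 + (φ (.ofAdd (Pi.single j 1)) - 1)) ^ q j = 1 := by
  rw [add_sub_cancel, ← map_pow, ← ofAdd_nsmul, ← Pi.single_smul]
  simp

variable [Fintype ι]

/-- By `gh - 1 = g(h - 1) + (g - 1)` the elements `a` with this property form a submonoid, and it
contains the generators. -/
theorem map_sub_one_mem_span [∀ j, NeZero (q j)]
    (φ : Multiplicative ((j : ι) → ZMod (q j)) →* R) (a : (j : ι) → ZMod (q j)) :
    φ (.ofAdd a) - 1 ∈ Ideal.span (Set.range fun j => φ (.ofAdd (Pi.single j 1)) - 1) := by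
  set I := Ideal.span (Set.range fun j => φ (.ofAdd (Pi.single j 1)) - 1)
  let H : AddSubmonoid ((j : ι) → ZMod (q j)) :=
    { carrier := {a | φ (.ofAdd a) - 1 ∈ I}
      zero_mem' := by simp
      add_mem' := fun {a b} ha hb => by
        have : φ (.ofAdd (a + b)) - 1 = φ (.ofAdd a) * (φ (.ofAdd b) - 1) + (φ (.ofAdd a) - 1) := by
          rw [ofAdd_add, map_mul]; ring
        simp only [Set.mem_ofPred_eq] at ha hb ⊢
        rw [this]
        exact I.add_mem (I.mul_mem_left _ hb) ha }
  change a ∈ H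
  rw [← Finset.univ_sum_single a]
  refine AddSubmonoid.sum_mem _ fun j _ => ?_
  have : Pi.single j (a j) = (a j).val • (Pi.single j 1 : (j : ι) → ZMod (q j)) := by
    rw [← Pi.single_smul]; simp
  rw [this]
  have hj : Pi.single j 1 ∈ H := Ideal.subset_span ⟨j, rfl⟩
  exact AddSubmonoid.nsmul_mem _ hj _

open Finset in
/-- A product of many elements of the augmentation ideal is divisible by `p ^ β`. -/
theorem pow_dvd_prod_map_sub_one {p : ℕ} (hp : p.Prime) {α : ι → ℕ} {b : ℕ}
    (hα : ∀ j, α j ≤ b + 1) (φ : Multiplicative ((j : ι) → ZMod (p ^ α j)) →* R) {β n : ℕ}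
    (hn : ∑ j, (p ^ α j - 1) + (β - 1) * ((p - 1) * p ^ b) < n)
    (a : Fin n → (j : ι) → ZMod (p ^ α j)) :
    (p : R) ^ β ∣ ∏ i, (φ (.ofAdd (a i)) - 1) := by
  have : ∀ j, NeZero (p ^ α j) := fun j => ⟨pow_ne_zero _ hp.ne_zero⟩
  -- Expanding the product gives a combination of monomials of total degree `n`, indexed by maps `κ
  -- : Fin n → ι`; the exponent of `x_j` is the size of the fibre of `κ` over `j`.
  choose c hc using fun i => Ideal.mem_span_range_iff_exists_fun.1 (map_sub_one_mem_span φ (a i))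
  rw [prod_congr rfl fun i _ => (hc i).symm, prod_univ_sum]
  refine dvd_sum fun κ _ => ?_
  rw [prod_mul_distrib]
  refine Dvd.dvd.mul_left ?_ _
  rw [← prod_fiberwise' univ κ fun j => φ (.ofAdd (Pi.single j 1)) - 1]
  simp only [prod_const]
  refine pow_dvd_prod_pow hp hα (fun j => map_single_pow_eq_one φ j) ?_
  rwa [← card_eq_sum_card_fiberwise fun _ _ => mem_coe.2 (mem_univ _), card_univ, Fintype.card_fin]

open Finset in
/-- Modulo `p`, the product of the `x j ^ (p ^ α j - 1)` is the sum of all group elements. -/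
theorem dvd_sum_sub_prod_pow {p : ℕ} (hp : p.Prime) {α : ι → ℕ} [∀ j, NeZero (p ^ α j)]
    (φ : Multiplicative ((j : ι) → ZMod (p ^ α j)) →* R) :
    (p : R) ∣ ∑ a, φ (.ofAdd a) - ∏ j, (φ (.ofAdd (Pi.single j 1)) - 1) ^ (p ^ α j - 1) := by
  -- The sum over the group is a product of geometric sums, each a pure power of `x_j` modulo `p`.
  have h1 : ∑ a, φ (.ofAdd a)
      = ∏ j, ∑ k ∈ range (p ^ α j), (1 + (φ (.ofAdd (Pi.single j 1)) - 1)) ^ k := by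
    have h2 : ∀ j, ∑ k ∈ range (p ^ α j), (1 + (φ (.ofAdd (Pi.single j 1)) - 1)) ^ k
        = ∑ z : ZMod (p ^ α j), φ (.ofAdd (Pi.single j z)) := by
      intro j
      refine sum_bij' (fun k _ => (k : ZMod (p ^ α j))) (fun z _ => z.val) (by simp)
        (fun z _ => by simpa using z.val_lt)
        (fun k hk => ZMod.val_cast_of_lt (by simpa using hk)) (by simp) fun k _ => ?_
      rw [add_sub_cancel, ← map_pow, ← ofAdd_nsmul, ← Pi.single_smul]
      simp
    rw [prod_congr rfl fun j _ => h2 j, prod_univ_sum, Fintype.piFinset_univ]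
    refine sum_congr rfl fun a _ => ?_
    rw [← map_prod, ← ofAdd_sum, univ_sum_single]
  rw [h1, ← Ideal.mem_span_singleton, ← Ideal.Quotient.eq, map_prod, map_prod]
  refine prod_congr rfl fun j _ => ?_
  obtain ⟨r, hr⟩ := exists_geom_sum_one_add_eq hp (α j) (φ (.ofAdd (Pi.single j 1)) - 1)
  rw [hr, Ideal.Quotient.eq, add_sub_cancel_left]
  exact Ideal.mul_mem_right _ _ (Ideal.mem_span_singleton_self _)

end PiZMod

/-- The top monomial is, up to sign, `p ^ i` times the sum of all group elements, modulo
`p ^ (i + 1)`. -/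
theorem pow_dvd_top_monomial_sub_sum {R : Type*} [CommRing R] {p : ℕ} (hp : p.Prime) {r c : ℕ}
    {α : Fin (r + 1) → ℕ} [∀ j, NeZero (p ^ α j)] (hc : α 0 = c + 1)
    (φ : Multiplicative ((j : Fin (r + 1)) → ZMod (p ^ α j)) →* R) (i : ℕ) :
    (p : R) ^ (i + 1) ∣ (∏ j, (φ (.ofAdd (Pi.single j 1)) - 1) ^ (p ^ α j - 1)) *
        (φ (.ofAdd (Pi.single 0 1)) - 1) ^ (i * ((p - 1) * p ^ c))
      - (-(p : R)) ^ i * ∑ a, φ (.ofAdd a) := by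
  have hd1 := pow_dvd_pow_sub_neg_pow_mul hp c (x := φ (.ofAdd (Pi.single 0 1)) - 1)
    (by rw [← hc]; exact map_single_pow_eq_one φ 0) i
  have hd2 := dvd_sum_sub_prod_pow hp φ
  generalize ∑ a, φ (.ofAdd a) = N at hd2 ⊢
  rw [Fin.prod_univ_succ] at hd2 ⊢
  generalize ∏ j : Fin r, (φ (.ofAdd (Pi.single j.succ 1)) - 1) ^ (p ^ α j.succ - 1) = P at hd2 ⊢
  generalize φ (.ofAdd (Pi.single 0 1)) - 1 = x at hd1 hd2 ⊢
  rw [hc] at hd2 ⊢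
  rw [pow_add x] at hd1
  have e : x ^ (p ^ (c + 1) - 1) * P * x ^ (i * ((p - 1) * p ^ c)) - (-(p : R)) ^ i * N
      = (x ^ (p ^ (c + 1) - 1) * x ^ (i * ((p - 1) * p ^ c))
          - (-(p : R)) ^ i * x ^ (p ^ (c + 1) - 1)) * P
        - (-(p : R)) ^ i * (N - x ^ (p ^ (c + 1) - 1) * P) := by ring
  rw [e]
  refine dvd_sub (Dvd.dvd.mul_right hd1 _) ?_
  rw [pow_succ]
  exact mul_dvd_mul (by rw [neg_pow]; exact Dvd.intro_left _ rfl) hd2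

/-! ### Difference operators as elements of the group ring -/

section Action

variable {A B : Type*} [AddCommGroup A] [AddCommGroup B]

/-- The translation operators on maps between commutative groups. -/
def translationHom (A B : Type*) [AddCommGroup A] [AddCommGroup B] :
    Multiplicative A →* Module.End ℤ (A → B) where
  toFun a := LinearMap.funLeft ℤ B (· + a.toAdd)
  map_one' := by ext f x; simp [LinearMap.funLeft_apply]
  map_mul' a b := by
    ext f x
    simp [LinearMap.funLeft_apply, add_comm, add_left_comm]

/-- The action of the integral group ring of `A` on the maps `A → B` by translations. -/
noncomputable def groupRingAction (A B : Type*) [AddCommGroup A] [AddCommGroup B] :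
    AddMonoidAlgebra ℤ A →ₐ[ℤ] Module.End ℤ (A → B) :=
  AddMonoidAlgebra.lift ℤ (Module.End ℤ (A → B)) A (translationHom A B)

theorem groupRingAction_of (a : A) (f : A → B) (x : A) :
    groupRingAction A B (AddMonoidAlgebra.of ℤ A (.ofAdd a)) f x = f (x + a) := by
  simp [groupRingAction, translationHom, LinearMap.funLeft_apply]

theorem groupRingAction_of_sub_one (a : A) (f : A → B) :
    groupRingAction A B (AddMonoidAlgebra.of ℤ A (.ofAdd a) - 1) f = fwdDiff a f := by
  ext x
  rw [map_sub, map_one, LinearMap.sub_apply, Pi.sub_apply, groupRingAction_of]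
  rfl

theorem foldr_fwdDiff (l : List A) (f : A → B) :
    l.foldr fwdDiff f = groupRingAction A B
      (l.map fun a => AddMonoidAlgebra.of ℤ A (.ofAdd a) - 1).prod f := by
  induction l with
  | nil => simp
  | cons a l ih =>
    rw [List.foldr_cons, ih, List.map_cons, List.prod_cons, map_mul, Module.End.mul_apply,
      groupRingAction_of_sub_one]

theorem fdegLE_iff_prod {f : A → B} {n : ℕ} :
    FdegLE f n ↔ ∀ a : Fin (n + 1) → A, groupRingAction A B
      (∏ i, (AddMonoidAlgebra.of ℤ A (.ofAdd (a i)) - 1)) f = 0 := by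
  simp only [FdegLE, foldr_fwdDiff, List.map_ofFn, List.prod_ofFn, Function.comp_def]

/-- Multisets make it possible to apply `FdegLE` to monomials with prescribed exponents. -/
theorem FdegLE.groupRingAction_multiset_prod {f : A → B} {n : ℕ} (hf : FdegLE f n)
    {s : Multiset A} (hs : s.card = n + 1) :
    groupRingAction A B
      (s.map fun a => AddMonoidAlgebra.of ℤ A (.ofAdd a) - 1).prod f = 0 := by
  have h : s.toList.length = n + 1 := by rw [Multiset.length_toList, hs]
  have h1 := hf fun i => s.toList.get (i.cast h.symm)
  have h2 : List.ofFn (fun i : Fin (n + 1) => s.toList.get (i.cast h.symm)) = s.toList := by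
    rw [← List.ofFn_congr h]; exact List.ofFn_get _
  rw [h2, foldr_fwdDiff, ← Multiset.prod_coe, ← Multiset.map_coe, Multiset.coe_toList] at h1
  exact h1

theorem groupRingAction_eq_zero_of_dvd {f : A → B} {k : ℕ} (hf : k • f = 0)
    {r : AddMonoidAlgebra ℤ A} (hr : (k : AddMonoidAlgebra ℤ A) ∣ r) :
    groupRingAction A B r f = 0 := by
  obtain ⟨s, rfl⟩ := hr
  rw [mul_comm, map_mul, Module.End.mul_apply, map_natCast, Module.End.natCast_apply, hf, map_zero]

theorem groupRingAction_sum_single [Fintype A] [DecidableEq A] (b : B) :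
    groupRingAction A B (∑ a, AddMonoidAlgebra.of ℤ A (.ofAdd a)) (Pi.single 0 b)
      = fun _ => b := by
  ext y
  rw [map_sum, LinearMap.sum_apply, Finset.sum_apply]
  simp only [groupRingAction_of]
  rw [Finset.sum_eq_single (-y)]
  · simp
  · intro z _ hz
    have : y + z ≠ 0 := fun h0 => hz (by rw [eq_neg_iff_add_eq_zero, add_comm, h0])
    simp [this]
  · simp

end Action

/-! ### The exact degree bound on a product of cyclic `p`-groups -/

section Degree

variable {B : Type*} [AddCommGroup B] {p : ℕ} {r : ℕ} {α : Fin (r + 1) → ℕ} {β : ℕ}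

theorem fdegLE_primaryDegree (hp : p.Prime) (hα : Antitone α) (hα0 : 1 ≤ α 0)
    {f : ((j : Fin (r + 1)) → ZMod (p ^ α j)) → B} (hf : p ^ β • f = 0) :
    FdegLE f (primaryDegree p r α β) := by
  refine fdegLE_iff_prod.2 fun a => groupRingAction_eq_zero_of_dvd hf ?_
  rw [Nat.cast_pow]
  refine pow_dvd_prod_map_sub_one hp (b := α 0 - 1) (fun j => ?_) _ ?_ a
  · have := hα (Fin.zero_le j); omega
  · rw [primaryDegree, mul_assoc]; exact Nat.lt_succ_self _

/-- The top monomial has degree `n + 1` and sends this map to the constant `±p^{β-1} b`, which is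
nonzero by the order of `b`. -/
theorem not_fdegLE_single (hp : p.Prime) (hα0 : 1 ≤ α 0) {b : B}
    (hβ : 1 ≤ β) (hb : addOrderOf b = p ^ β) {n : ℕ} (hn : n + 1 = primaryDegree p r α β) :
    ¬ FdegLE (Pi.single 0 b : ((j : Fin (r + 1)) → ZMod (p ^ α j)) → B) n := by
  intro h
  set A := (j : Fin (r + 1)) → ZMod (p ^ α j)
  have : ∀ j, NeZero (p ^ α j) := fun j => ⟨pow_ne_zero _ hp.ne_zero⟩
  obtain ⟨c, hc⟩ : ∃ c, α 0 = c + 1 := ⟨α 0 - 1, by omega⟩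
  obtain ⟨i, rfl⟩ : ∃ i, β = i + 1 := ⟨β - 1, by omega⟩
  set f : A → B := Pi.single 0 b with hf
  have hpf : p ^ (i + 1) • f = 0 := by
    rw [hf, ← Pi.single_smul, ← hb, addOrderOf_nsmul_eq_zero, Pi.single_zero]
  let φ := AddMonoidAlgebra.of ℤ A
  let x : Fin (r + 1) → AddMonoidAlgebra ℤ A := fun j => φ (.ofAdd (Pi.single j 1)) - 1
  have h1 := h.groupRingAction_multiset_prod
    (s := (∑ j, Multiset.replicate (p ^ α j - 1) (Pi.single j 1))
      + Multiset.replicate (i * ((p - 1) * p ^ c)) (Pi.single 0 1))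
    (by simp [hn, primaryDegree, hc, mul_assoc])
  rw [Multiset.map_add, Multiset.prod_add,
    ← Multiset.coe_mapAddMonoidHom, map_sum, Multiset.prod_sum] at h1
  simp only [Multiset.coe_mapAddMonoidHom, Multiset.map_replicate, Multiset.prod_replicate] at h1
  change groupRingAction A B ((∏ j, x j ^ (p ^ α j - 1)) * x 0 ^ (i * ((p - 1) * p ^ c))) f = 0
    at h1
  have hd := pow_dvd_top_monomial_sub_sum hp hc φ i
  rw [← Nat.cast_pow] at hd
  have h2 := groupRingAction_eq_zero_of_dvd hpf hd
  rw [map_sub, LinearMap.sub_apply, h1, zero_sub, neg_eq_zero, map_mul, Module.End.mul_apply] at h2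
  have h3 := groupRingAction_sum_single (A := A) b
  rw [h3, neg_pow, map_mul, Module.End.mul_apply, ← Nat.cast_pow, map_natCast,
    Module.End.natCast_apply] at h2
  have h4 : p ^ i • b = 0 := by
    have h5 := congrFun h2 0
    rcases neg_one_pow_eq_or (AddMonoidAlgebra ℤ A) i with h6 | h6 <;> rw [h6] at h5 <;>
      simpa using h5
  have h7 := addOrderOf_dvd_of_nsmul_eq_zero h4
  rw [hb] at h7
  have := (Nat.pow_dvd_pow_iff_le_right hp.one_lt).1 h7
  omega

end Degree

/-! ### Functoriality of the functional degree and of `deltaCirc` -/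

section Fdeg

variable {A A' B B' : Type*} [AddCommGroup A] [AddCommGroup A'] [AddCommGroup B] [AddCommGroup B']

theorem FdegLE.mono {f : A → B} {m n : ℕ} (hf : FdegLE f m) (hmn : m ≤ n) : FdegLE f n := by
  induction n, hmn using Nat.le_induction with
  | base => exact hf
  | succ n _ ih =>
    intro a
    rw [List.ofFn_succ, List.foldr_cons, ih]
    ext x
    simp [fwdDiff]

theorem foldr_fwdDiff_comp (l : List A) (f : A' → B) (π : A →+ A') :
    l.foldr fwdDiff (f ∘ π) = (l.map π).foldr fwdDiff f ∘ π := by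
  induction l with
  | nil => rfl
  | cons a l ih =>
    rw [List.foldr_cons, ih]
    ext x
    simp [fwdDiff]

theorem foldr_fwdDiff_map_comp (l : List A) (f : A → B) (ι : B →+ B') :
    l.foldr fwdDiff (ι ∘ f) = ι ∘ l.foldr fwdDiff f := by
  induction l with
  | nil => rfl
  | cons a l ih =>
    rw [List.foldr_cons, ih]
    ext x
    simp [fwdDiff]

theorem fdegLE_zero (n : ℕ) : FdegLE (0 : A → B) n := fun _ => by rw [foldr_fwdDiff, map_zero]

theorem FdegLE.comp {f : A' → B} {n : ℕ} (hf : FdegLE f n) (π : A →+ A') : FdegLE (f ∘ π) n := by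
  intro a
  rw [foldr_fwdDiff_comp, List.map_ofFn, hf]
  rfl

theorem fdegLE_comp_iff {f : A' → B} {n : ℕ} {π : A →+ A'} (hπ : Function.Surjective π) :
    FdegLE (f ∘ π) n ↔ FdegLE f n := by
  refine ⟨fun h a => ?_, fun h => h.comp π⟩
  choose a' ha' using fun i => hπ (a i)
  have h1 := h a'
  rw [foldr_fwdDiff_comp, List.map_ofFn, show π ∘ a' = a from funext ha'] at h1
  exact hπ.injective_comp_right (h1.trans rfl)

theorem FdegLE.map_comp {f : A → B} {n : ℕ} (hf : FdegLE f n) (ι : B →+ B') :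
    FdegLE (ι ∘ f) n := by
  intro a
  rw [foldr_fwdDiff_map_comp, hf]
  ext x
  simp

theorem fdegLE_of_jointly_injective {κ : Type*} {C : κ → Type*} [∀ k, AddCommGroup (C k)]
    (π : (k : κ) → B →+ C k) (hπ : ∀ b, (∀ k, π k b = 0) → b = 0) {f : A → B} {n : ℕ}
    (h : ∀ k, FdegLE (π k ∘ f) n) : FdegLE f n := by
  intro a
  ext x
  refine hπ _ fun k => ?_
  have h1 := h k a
  rw [foldr_fwdDiff_map_comp] at h1
  exact congrFun h1 x

theorem fdeg_congr {f : A → B} {g : A' → B'} (h0 : f = 0 ↔ g = 0)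
    (h : ∀ n, FdegLE f n ↔ FdegLE g n) : fdeg f = fdeg g := by
  by_cases hg : g = 0
  · simp [fdeg, hg, h0.2 hg]
  · simp [fdeg, hg, mt h0.1 hg, h]

theorem fdeg_comp {f : A' → B} {π : A →+ A'} (hπ : Function.Surjective π) :
    fdeg (f ∘ π) = fdeg f :=
  fdeg_congr (hπ.injective_comp_right.eq_iff' rfl) fun _ => fdegLE_comp_iff hπ

theorem fdeg_map_comp {f : A → B} {ι : B →+ B'} (hι : Function.Injective ι) :
    fdeg (ι ∘ f) = fdeg f := by
  refine fdeg_congr ⟨fun h => ?_, fun h => ?_⟩ fun n => ⟨fun h => ?_, fun h => h.map_comp ι⟩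
  · ext x
    exact hι (by simpa using congrFun h x)
  · ext x
    simp [h]
  · exact fdegLE_of_jointly_injective (fun _ : Unit => ι)
      (fun b hb => hι (by simpa using hb ())) fun _ => h

theorem fdeg_le_bot_iff {f : A → B} : fdeg f ≤ ⊥ ↔ f = 0 := by
  rw [le_bot_iff, fdeg]
  split_ifs with h <;> simp [h]

theorem fdeg_le_coe_iff {f : A → B} {n : ℕ} :
    fdeg f ≤ ((n : ℕ∞) : WithBot ℕ∞) ↔ FdegLE f n := by
  by_cases h0 : f = 0
  · subst h0
    simp [fdeg, fdegLE_zero]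
  rw [fdeg, if_neg h0, WithBot.coe_le_coe]
  refine ⟨fun h => ?_, fun h => sInf_le ⟨n, rfl, h⟩⟩
  -- The infimum of the empty set is `⊤`, which is not at most `n`; so the infimum is attained.
  have hne : {m : ℕ∞ | ∃ n : ℕ, m = n ∧ FdegLE f n}.Nonempty := by
    by_contra hne
    rw [Set.not_nonempty_iff_eq_empty.1 hne, sInf_empty] at h
    exact absurd h (by simp)
  obtain ⟨k, hk, hfk⟩ := csInf_mem hne
  rw [hk] at h
  exact hfk.mono (by exact_mod_cast h)

theorem withBot_enat_cases (d : WithBot ℕ∞) :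
    d = ⊥ ∨ (∃ n : ℕ, d = ((n : ℕ∞) : WithBot ℕ∞)) ∨ d = ⊤ := by
  induction d with
  | bot => exact Or.inl rfl
  | coe d =>
    induction d with
    | top => exact Or.inr (Or.inr rfl)
    | coe n => exact Or.inr (Or.inl ⟨n, rfl⟩)

theorem fdeg_lt_top_iff {f : A → B} : fdeg f < ⊤ ↔ ∃ n, FdegLE f n := by
  constructor
  · intro h
    rcases withBot_enat_cases (fdeg f) with h1 | ⟨n, h1⟩ | h1
    · exact ⟨0, by rw [fdeg_le_bot_iff.1 h1.le]; exact fdegLE_zero 0⟩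
    · exact ⟨n, fdeg_le_coe_iff.1 h1.le⟩
    · exact absurd h (by simp [h1])
  · rintro ⟨n, h⟩
    exact (fdeg_le_coe_iff.2 h).trans_lt (WithBot.coe_lt_coe.2 (ENat.natCast_lt_top n))

theorem coe_succ_le_fdeg {f : A → B} {n : ℕ} (h : ¬ FdegLE f n) :
    (((n + 1 : ℕ) : ℕ∞) : WithBot ℕ∞) ≤ fdeg f := by
  rcases withBot_enat_cases (fdeg f) with h1 | ⟨k, h1⟩ | h1
  · exact absurd (by rw [fdeg_le_bot_iff.1 h1.le]; exact fdegLE_zero n) h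
  · have h2 := fdeg_le_coe_iff.1 h1.le
    have : n + 1 ≤ k := by
      by_contra hk
      exact h (h2.mono (by omega))
    rw [h1]
    exact_mod_cast this
  · rw [h1]; exact le_top

theorem fdeg_le_of_jointly_injective {κ : Type*} {C : κ → Type*} [∀ k, AddCommGroup (C k)]
    (π : (k : κ) → B →+ C k) (hπ : ∀ b, (∀ k, π k b = 0) → b = 0) {f : A → B} {D : WithBot ℕ∞}
    (h : ∀ k, fdeg (π k ∘ f) ≤ D) : fdeg f ≤ D := by
  rcases withBot_enat_cases D with rfl | ⟨n, rfl⟩ | rfl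
  · simp only [fdeg_le_bot_iff] at h ⊢
    ext x
    exact hπ _ fun k => congrFun (h k) x
  · simp only [fdeg_le_coe_iff] at h ⊢
    exact fdegLE_of_jointly_injective π hπ h
  · exact le_top

theorem FdegLE.fdeg_le_deltaCirc {f : A → B} {n : ℕ} (hf : FdegLE f n) :
    fdeg f ≤ deltaCirc A B :=
  le_sSup ⟨f, rfl, fdeg_lt_top_iff.2 ⟨n, hf⟩⟩

theorem deltaCirc_le {D : WithBot ℕ∞} (h : ∀ (f : A → B) (n : ℕ), FdegLE f n → fdeg f ≤ D) :
    deltaCirc A B ≤ D := by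
  refine sSup_le ?_
  rintro _ ⟨f, rfl, hf⟩
  obtain ⟨n, hn⟩ := fdeg_lt_top_iff.1 hf
  exact h f n hn

theorem deltaCirc_le_of_surjective {π : A →+ A'} (hπ : Function.Surjective π) :
    deltaCirc A' B ≤ deltaCirc A B :=
  deltaCirc_le fun f _ hf => by
    rw [← fdeg_comp hπ]
    exact (hf.comp π).fdeg_le_deltaCirc

theorem deltaCirc_le_of_injective {ι : B →+ B'} (hι : Function.Injective ι) :
    deltaCirc A B ≤ deltaCirc A B' :=
  deltaCirc_le fun f _ hf => by
    rw [← fdeg_map_comp hι]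
    exact (hf.map_comp ι).fdeg_le_deltaCirc

theorem zero_le_deltaCirc [Nontrivial B] : 0 ≤ deltaCirc A B := by
  obtain ⟨b, hb⟩ := exists_ne (0 : B)
  have h : FdegLE (fun _ : A => b) 0 := fun a => by
    ext x
    simp [fwdDiff]
  refine le_trans ?_ h.fdeg_le_deltaCirc
  rw [fdeg, if_neg fun h0 => hb (congrFun h0 0)]
  exact WithBot.coe_le_coe.2 zero_le

theorem deltaCirc_eq_bot_of_subsingleton [Subsingleton B] : deltaCirc A B = ⊥ :=
  le_bot_iff.1 (deltaCirc_le fun _ _ _ => fdeg_le_bot_iff.2 (Subsingleton.elim _ _))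

theorem deltaCirc_le_zero_of_subsingleton [Subsingleton A] : deltaCirc A B ≤ 0 :=
  deltaCirc_le fun _ _ _ => fdeg_le_coe_iff.2 fun a => by
    ext x
    simp [fwdDiff, Subsingleton.elim (x + a 0) x]

/-- A map of finite functional degree into a `p`-group is invariant under translations by elements
of order prime to `p`. -/
theorem FdegLE.apply_add_eq {p m n : ℕ} (hB : ∀ b : B, ∃ k : ℕ, p ^ k • b = 0) {f : A → B}
    (hf : FdegLE f n) {a : A} (hm : m.Coprime p) (ha : m • a = 0) (x : A) : f (x + a) = f x := by
  set X := AddMonoidAlgebra.of ℤ A (.ofAdd a) - 1 with hX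
  have hXm : (1 + X) ^ m = 1 := by
    rw [hX, add_sub_cancel, ← map_pow, ← ofAdd_nsmul, ha, ofAdd_zero, map_one]
  set N := ∑ k ∈ Finset.range m, (1 + X) ^ k with hN
  have hXN : N * X = 0 := by
    have h := geom_sum_mul (1 + X) m
    rwa [hXm, sub_self, add_sub_cancel_left] at h
  obtain ⟨s, hs⟩ : X ∣ N - m := by
    have : N - (m : AddMonoidAlgebra ℤ A) = ∑ k ∈ Finset.range m, ((1 + X) ^ k - 1) := by
      simp [hN]
    rw [this]
    refine Finset.dvd_sum fun k _ => ?_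
    simpa using sub_dvd_pow_sub_pow (1 + X) 1 k
  -- Since `N X = 0` and `N = m + X s`, `m X^{k+1}` is a multiple of `X^{k+2}`. Thus `m` kills
  -- `X^{k+1} f`, whose values have `p`-power order prime to `m`.
  have hstep : ∀ k, groupRingAction A B (X ^ (k + 2)) f = 0 →
      groupRingAction A B (X ^ (k + 1)) f = 0 := by
    intro k hk
    have e : (m : AddMonoidAlgebra ℤ A) * X ^ (k + 1) = X ^ k * (N * X) - s * X ^ (k + 2) := by
      linear_combination (-X ^ (k + 1)) * hs
    have h1 : groupRingAction A B (m * X ^ (k + 1)) f = 0 := by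
      rw [e, hXN, mul_zero, zero_sub, map_neg, map_mul, LinearMap.neg_apply,
        Module.End.mul_apply, hk, map_zero, neg_zero]
    rw [map_mul, map_natCast, Module.End.mul_apply, Module.End.natCast_apply] at h1
    ext y
    obtain ⟨j, hj⟩ := hB (groupRingAction A B (X ^ (k + 1)) f y)
    have h2 : m • groupRingAction A B (X ^ (k + 1)) f y = 0 := congrFun h1 y
    have h3 := Nat.dvd_gcd (addOrderOf_dvd_of_nsmul_eq_zero h2)
      (addOrderOf_dvd_of_nsmul_eq_zero hj)
    rw [Nat.Coprime.gcd_eq_one (hm.pow_right j), Nat.dvd_one, AddMonoid.addOrderOf_eq_one_iff]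
      at h3
    exact h3
  have hn : groupRingAction A B (X ^ (n + 1)) f = 0 := by
    have h := hf.groupRingAction_multiset_prod (s := Multiset.replicate (n + 1) a) (by simp)
    rwa [Multiset.map_replicate, Multiset.prod_replicate] at h
  have h1 : ∀ k, groupRingAction A B (X ^ (k + 1)) f = 0 → groupRingAction A B (X ^ 1) f = 0 := by
    intro k
    induction k with
    | zero => exact id
    | succ k ih => exact fun h => ih (hstep k h)
  have h2 := h1 n hn
  rw [pow_one, hX, groupRingAction_of_sub_one] at h2
  exact sub_eq_zero.1 (congrFun h2 x)

end Fdeg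

/-! ### Reduction to primary components -/

section PrimaryComponent

open AddCommGroup

/-- The elements killed by a number prime to `p` form a complement of the primary component, by
Bézout; `π` is the projection along it. -/
theorem exists_primaryComponent_projection {G : Type*} [AddCommGroup G] (hG : IsAddTorsion G)
    {p : ℕ} (hp : p.Prime) :
    ∃ π : G →+ primaryComponent G p, (∀ x : primaryComponent G p, π x = x) ∧
      ∀ g, π g = 0 → ∃ m : ℕ, m.Coprime p ∧ m • g = 0 := by
  let P : Submodule ℤ G := AddSubgroup.toIntSubmodule (primaryComponent G p)
  let Q : Submodule ℤ G := AddSubgroup.toIntSubmodule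
    { carrier := {g | ∃ m : ℕ, m.Coprime p ∧ m • g = 0}
      zero_mem' := ⟨1, by simp⟩
      add_mem' := by
        rintro a b ⟨m, hm, ha⟩ ⟨n, hn, hb⟩
        refine ⟨m * n, hm.mul_left hn, ?_⟩
        rw [nsmul_add, mul_comm, mul_nsmul', ha, mul_comm, mul_nsmul', hb]
        simp
      neg_mem' := by
        rintro a ⟨m, hm, ha⟩
        exact ⟨m, hm, by rw [smul_neg, ha, neg_zero]⟩ }
  have hPQ : IsCompl P Q := by
    constructor
    · rw [Submodule.disjoint_def]
      rintro x ⟨k, hk⟩ ⟨m, hm, hx⟩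
      have h3 := Nat.dvd_gcd (addOrderOf_dvd_of_nsmul_eq_zero hx)
        (addOrderOf_dvd_of_nsmul_eq_zero hk)
      rwa [Nat.Coprime.gcd_eq_one (hm.pow_right k), Nat.dvd_one,
        AddMonoid.addOrderOf_eq_one_iff] at h3
    · rw [codisjoint_iff, eq_top_iff]
      intro x _
      have hx : addOrderOf x ≠ 0 := (addOrderOf_pos_iff.2 (hG x)).ne'
      obtain ⟨e, m, hm, hem⟩ := Nat.exists_eq_pow_mul_and_not_dvd hx p hp.ne_one
      have hcop : Nat.Coprime (p ^ e) m := ((hp.coprime_iff_not_dvd).2 hm).pow_left e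
      have hbez := Nat.gcd_eq_gcd_ab (p ^ e) m
      rw [hcop.gcd_eq_one, Nat.cast_one] at hbez
      have h0 : (p ^ e * m) • x = 0 := by rw [← hem]; exact addOrderOf_nsmul_eq_zero x
      refine Submodule.mem_sup.2 ⟨((m : ℤ) * Nat.gcdB (p ^ e) m) • x, ⟨e, ?_⟩,
        (((p ^ e : ℕ) : ℤ) * Nat.gcdA (p ^ e) m) • x,
        ⟨m, ((hp.coprime_iff_not_dvd).2 hm).symm, ?_⟩, ?_⟩
      · rw [← natCast_zsmul, smul_smul, ← mul_assoc, mul_comm, mul_smul, ← Nat.cast_mul,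
          natCast_zsmul, h0, smul_zero]
      · rw [← natCast_zsmul, smul_smul, ← mul_assoc, mul_comm, mul_smul, ← Nat.cast_mul,
          natCast_zsmul, mul_comm m, h0, smul_zero]
      · rw [← add_smul, add_comm, ← hbez, one_smul]
  refine ⟨(P.projectionOnto Q hPQ).toAddMonoidHom,
    fun x => Submodule.projectionOnto_apply_left hPQ x, fun g hg => ?_⟩
  exact (Submodule.projectionOnto_apply_eq_zero_iff hPQ).1 hg

theorem deltaCirc_eq_iSup_primaryComponent {A B : Type*} [AddCommGroup A] [AddCommGroup B]
    (hA : IsAddTorsion A) (hB : IsAddTorsion B) :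
    deltaCirc A B =
      ⨆ p : Nat.Primes, deltaCirc (primaryComponent A p) (primaryComponent B p) := by
  choose πA hA1 hA2 using fun p : Nat.Primes => exists_primaryComponent_projection hA p.2
  choose πB hB1 hB2 using fun p : Nat.Primes => exists_primaryComponent_projection hB p.2
  have hsurj : ∀ p, Function.Surjective (πA p) := fun p x => ⟨x, hA1 p x⟩
  refine le_antisymm (deltaCirc_le fun f n hf => ?_) (iSup_le fun p => ?_)
  · refine fdeg_le_of_jointly_injective πB (fun b hb => ?_) fun p => ?_
    · by_contra hb0
      rw [← AddMonoid.addOrderOf_eq_one_iff] at hb0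
      obtain ⟨p, hp, hpb⟩ := Nat.exists_prime_and_dvd hb0
      obtain ⟨m, hm, hmb⟩ := hB2 ⟨p, hp⟩ b (hb ⟨p, hp⟩)
      exact (hp.coprime_iff_not_dvd.1 hm.symm) (hpb.trans (addOrderOf_dvd_of_nsmul_eq_zero hmb))
    · have hg := hf.map_comp (πB p)
      -- The difference `x - πA p x` has order prime to `p`, so translation by it does not change
      -- `πB p ∘ f`.
      have e : πB p ∘ f = ((πB p ∘ f) ∘ (primaryComponent A (p : ℕ)).subtype) ∘ πA p := by
        ext1 x
        obtain ⟨m, hm, hmx⟩ := hA2 p (x - πA p x) (by rw [map_sub, hA1, sub_self])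
        have h := hg.apply_add_eq (p := p) (fun b => ?_) hm hmx (πA p x)
        · rwa [add_sub_cancel] at h
        · obtain ⟨k, hk⟩ := b.2
          exact ⟨k, Subtype.ext (by simpa using hk)⟩
      rw [e, fdeg_comp (hsurj p)]
      exact (hg.comp _).fdeg_le_deltaCirc.trans (le_iSup (fun p : Nat.Primes =>
        deltaCirc (primaryComponent A p) (primaryComponent B p)) p)
  · exact (deltaCirc_le_of_surjective (hsurj p)).trans
      (deltaCirc_le_of_injective (AddSubgroup.subtype_injective _))

end PrimaryComponent

/-! ### Formula and lower bounds for `p`-groups -/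

section PrimaryGroups

variable {G B : Type*} [AddCommGroup G] [AddCommGroup B] {p : ℕ}

theorem primaryDegree_pos (hp : p.Prime) {r : ℕ} {α : Fin (r + 1) → ℕ} (hα0 : 1 ≤ α 0) (β : ℕ) :
    1 ≤ primaryDegree p r α β := by
  have h1 : p ^ α 0 - 1 ≤ ∑ j, (p ^ α j - 1) :=
    Finset.single_le_sum (f := fun j => p ^ α j - 1) (fun _ _ => Nat.zero_le _)
      (Finset.mem_univ 0)
  have h2 := Nat.pow_le_pow_right hp.pos hα0
  have h3 := hp.two_le
  rw [pow_one] at h2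
  rw [primaryDegree]
  omega

theorem primaryDegree_le_deltaCirc (hp : p.Prime) {r : ℕ} {α : Fin (r + 1) → ℕ} (hα : Antitone α)
    (hα0 : 1 ≤ α 0) {π : G →+ ((j : Fin (r + 1)) → ZMod (p ^ α j))}
    (hπ : Function.Surjective π) {β : ℕ} (hβ : 1 ≤ β) {b : B} (hb : addOrderOf b = p ^ β) :
    ((primaryDegree p r α β : ℕ∞) : WithBot ℕ∞) ≤ deltaCirc G B := by
  obtain ⟨n, hn⟩ : ∃ n, primaryDegree p r α β = n + 1 :=
    ⟨_, (Nat.sub_add_cancel (primaryDegree_pos hp hα0 β)).symm⟩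
  refine le_trans ?_ (deltaCirc_le_of_surjective hπ)
  have hf : p ^ β • (Pi.single 0 b : ((j : Fin (r + 1)) → ZMod (p ^ α j)) → B) = 0 := by
    rw [← Pi.single_smul, ← hb, addOrderOf_nsmul_eq_zero, Pi.single_zero]
  refine le_trans ?_ (fdegLE_primaryDegree hp hα hα0 hf).fdeg_le_deltaCirc
  rw [hn]
  exact coe_succ_le_fdeg (not_fdegLE_single hp hα0 hβ hb hn.symm)

theorem deltaCirc_le_primaryDegree (hp : p.Prime) {r : ℕ} {α : Fin (r + 1) → ℕ} (hα : Antitone α)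
    (hα0 : 1 ≤ α 0) (e : G ≃+ ((j : Fin (r + 1)) → ZMod (p ^ α j))) {β : ℕ}
    (hB : ∀ b : B, p ^ β • b = 0) :
    deltaCirc G B ≤ ((primaryDegree p r α β : ℕ∞) : WithBot ℕ∞) := by
  refine deltaCirc_le fun f _ _ => fdeg_le_coe_iff.2 ?_
  have h := fdegLE_primaryDegree (B := B) (β := β) hp hα hα0 (f := f ∘ e.symm)
    (by ext x; exact hB _)
  exact (fdegLE_comp_iff (π := e.symm.toAddMonoidHom) e.symm.surjective).1 h

/-- The degree formula for a finite `p`-group and a `p`-group of finite exponent. -/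
theorem HasPrimaryType.deltaCirc_eq [Nontrivial G] [Nontrivial B] (hp : p.Prime) {r : ℕ}
    {α : Fin (r + 1) → ℕ} {β : ℕ} (h : HasPrimaryType G B p r α β) :
    deltaCirc G B = ((primaryDegree p r α β : ℕ∞) : WithBot ℕ∞) := by
  obtain ⟨e⟩ := h.iso
  have hα0 : 1 ≤ α 0 := by
    by_contra h0
    have hα : ∀ j, α j = 0 := fun j => by have := h.antitone (Fin.zero_le j); omega
    have : ∀ j, Subsingleton (ZMod (p ^ α j)) := fun j => by
      rw [hα, pow_zero]; infer_instance
    exact not_subsingleton G e.toEquiv.subsingleton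
  have hβ : 1 ≤ β := by
    by_contra h0
    have h1 := h.exponent_eq
    rw [show β = 0 by omega, pow_zero, AddMonoid.exp_eq_one_iff] at h1
    exact not_subsingleton B h1
  refine le_antisymm (deltaCirc_le_primaryDegree hp h.antitone hα0 e fun b => ?_) ?_
  · rw [← h.exponent_eq]
    exact AddMonoid.exponent_nsmul_eq_zero b
  · have hex : AddMonoid.ExponentExists B := by
      rw [← AddMonoid.exponent_ne_zero, h.exponent_eq]
      exact pow_ne_zero _ hp.ne_zero
    obtain ⟨b, hb⟩ := AddMonoid.exists_addOrderOf_eq_exponent hex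
    exact primaryDegree_le_deltaCirc hp h.antitone hα0 (π := e.toAddMonoidHom) e.surjective hβ
      (hb.trans h.exponent_eq)

theorem exponent_eq_prime_pow (hp : p.Prime) (hG : ∀ g : G, ∃ k : ℕ, p ^ k • g = 0)
    (hex : AddMonoid.ExponentExists G) : ∃ k, AddMonoid.exponent G = p ^ k := by
  obtain ⟨g, hg⟩ := AddMonoid.exists_addOrderOf_eq_exponent hex
  obtain ⟨k, hk⟩ := hG g
  obtain ⟨j, -, hj⟩ := (Nat.dvd_prime_pow hp).1 (addOrderOf_dvd_of_nsmul_eq_zero hk)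
  exact ⟨j, hg ▸ hj⟩

open DirectSum in
theorem exists_addEquiv_pi_zmod_prime_pow (hp : p.Prime) (hG : ∀ g : G, ∃ k : ℕ, p ^ k • g = 0)
    [Finite G] [Nontrivial G] :
    ∃ (r : ℕ) (α : Fin (r + 1) → ℕ), Antitone α ∧
      Nonempty (G ≃+ ((j : Fin (r + 1)) → ZMod (p ^ α j))) := by
  have htor : Module.IsTorsion' G (Submonoid.powers (p : ℤ)) :=
    (Submodule.isTorsion'_powers_iff _).2 fun g => by
      obtain ⟨k, hk⟩ := hG g
      exact ⟨k, by rw [← Nat.cast_pow, natCast_zsmul, hk]⟩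
  obtain ⟨d, k, ⟨e⟩⟩ := Module.torsion_by_prime_power_decomposition
    (Nat.prime_iff_prime_int.1 hp).irreducible htor
  have e1 : G ≃+ ((i : Fin d) → ZMod (p ^ k i)) :=
    e.toAddEquiv.trans ((DirectSum.addEquivProd _).trans (AddEquiv.piCongrRight fun i =>
      (Submodule.quotEquivOfEq _ _ (by rw [Nat.cast_pow]) |>.toAddEquiv).trans
        (Int.quotientSpanNatEquivZMod (p ^ k i)).toAddEquiv))
  obtain _ | r := d
  · exact absurd e1.toEquiv.subsingleton (not_subsingleton G)
  -- `Tuple.sort` sorts increasingly, hence the reversal.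
  · let σ : Equiv.Perm (Fin (r + 1)) := Fin.revPerm.trans (Tuple.sort k)
    refine ⟨r, k ∘ σ, ?_, ⟨e1.trans ?_⟩⟩
    · exact (Tuple.monotone_sort k).comp_antitone Fin.rev_anti
    · exact { (Equiv.piCongrLeft (fun i => ZMod (p ^ k i)) σ).symm with
        map_add' := fun _ _ => rfl }

/-- Nakayama: iterating `G = K + pG` gives `G = K + p^k G = K`. -/
theorem eq_top_of_forall_exists_add_nsmul {k : ℕ} (hk : ∀ g : G, p ^ k • g = 0)
    {K : AddSubgroup G} (hK : ∀ g, ∃ x ∈ K, ∃ g', g = x + p • g') : K = ⊤ := by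
  have h : ∀ j : ℕ, ∀ g, ∃ x ∈ K, ∃ g', g = x + p ^ j • g' := by
    intro j
    induction j with
    | zero => exact fun g => ⟨0, K.zero_mem, g, by simp⟩
    | succ j ih =>
      intro g
      obtain ⟨x, hx, g', rfl⟩ := ih g
      obtain ⟨y, hy, g'', rfl⟩ := hK g'
      refine ⟨x + p ^ j • y, K.add_mem hx (K.nsmul_mem hy _), g'', ?_⟩
      rw [smul_add, smul_smul, ← pow_succ, add_assoc]
  rw [eq_top_iff]
  intro g _
  obtain ⟨x, hx, g', rfl⟩ := h k g
  simpa [hk] using hx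

theorem exists_surjective_of_embedding_basis {F V ι κ : Type*} [Field F] [AddCommGroup V]
    [Module F V] [Fintype κ] (b : Module.Basis ι F V) (e : κ ↪ ι) :
    ∃ φ : V →ₗ[F] (κ → F), Function.Surjective φ := by
  classical
  refine ⟨LinearMap.pi fun i => b.coord (e i), fun y => ⟨∑ i, y i • b (e i), ?_⟩⟩
  ext i
  simp [Finsupp.single_apply, e.injective.eq_iff]

/-- Coordinates on the `𝔽_p`-space `G/pG` give the map. If that space were finite, lifts of its
elements would generate `G` by Nakayama, and a finitely generated torsion group is finite. -/
theorem exists_surjective_pi_zmod (hp : p.Prime) {k : ℕ} (hk : ∀ g : G, p ^ k • g = 0) (r : ℕ)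
    (h : Infinite G ∨ (r = 0 ∧ Nontrivial G)) :
    ∃ π : G →+ (Fin (r + 1) → ZMod p), Function.Surjective π := by
  have : Fact p.Prime := ⟨hp⟩
  let H : AddSubgroup G := (nsmulAddMonoidHom p : G →+ G).range
  let _ : Module (ZMod p) (G ⧸ H) := QuotientAddGroup.zmodModule fun x => ⟨x, rfl⟩
  let b := Module.Basis.ofVectorSpace (ZMod p) (G ⧸ H)
  suffices hemb : Nonempty (Fin (r + 1) ↪ Module.Basis.ofVectorSpaceIndex (ZMod p) (G ⧸ H)) by
    obtain ⟨e⟩ := hemb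
    obtain ⟨φ, hφ⟩ := exists_surjective_of_embedding_basis b e
    exact ⟨φ.toAddMonoidHom.comp (QuotientAddGroup.mk' H),
      hφ.comp (QuotientAddGroup.mk'_surjective H)⟩
  rcases h with h | ⟨rfl, h⟩
  · suffices hinf : Infinite (Module.Basis.ofVectorSpaceIndex (ZMod p) (G ⧸ H)) from
      ⟨Fin.valEmbedding.trans (Infinite.natEmbedding _)⟩
    by_contra hfin
    rw [not_infinite_iff_finite] at hfin
    have : Finite (G ⧸ H) := Finite.of_equiv _ b.equivFun.symm.toEquiv
    have htop : AddSubgroup.closure (Set.range (Quotient.out : G ⧸ H → G)) = ⊤ := by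
      refine eq_top_of_forall_exists_add_nsmul hk fun g => ?_
      obtain ⟨g', hg'⟩ : -(Quotient.out (g : G ⧸ H)) + g ∈ H :=
        QuotientAddGroup.eq.1 (Quotient.out_eq _)
      refine ⟨_, AddSubgroup.subset_closure ⟨(g : G ⧸ H), rfl⟩, g', ?_⟩
      change p • g' = _ at hg'
      rw [hg', add_neg_cancel_left]
    have hfg : AddGroup.FG G := (AddGroup.fg_iff).2 ⟨_, htop, Set.finite_range _⟩
    have := AddCommGroup.finite_of_fg_isAddTorsion G fun g =>
      isOfFinAddOrder_iff_nsmul_eq_zero.2 ⟨p ^ k, pow_pos hp.pos k, hk g⟩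
    exact not_finite G
  · suffices hne : Nonempty (Module.Basis.ofVectorSpaceIndex (ZMod p) (G ⧸ H)) from
      ⟨⟨fun _ => hne.some, fun _ _ _ => Subsingleton.elim (α := Fin 1) _ _⟩⟩
    by_contra hempty
    rw [not_nonempty_iff] at hempty
    have hsub : Subsingleton (G ⧸ H) := b.repr.toEquiv.subsingleton
    have htop : (⊥ : AddSubgroup G) = ⊤ := by
      refine eq_top_of_forall_exists_add_nsmul hk fun g => ?_
      obtain ⟨g', hg'⟩ : g ∈ H :=
        (QuotientAddGroup.eq_zero_iff g).1 (Subsingleton.elim (α := G ⧸ H) _ _)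
      exact ⟨0, zero_mem _, g', by rw [zero_add]; exact hg'.symm⟩
    exact bot_ne_top htop

theorem mul_le_deltaCirc (hp : p.Prime) {k : ℕ} (hk : ∀ g : G, p ^ k • g = 0) {r : ℕ}
    (h : Infinite G ∨ (r = 0 ∧ Nontrivial G)) {β : ℕ} (hβ : 1 ≤ β) {b : B}
    (hb : addOrderOf b = p ^ β) :
    ((((r + β) * (p - 1) : ℕ) : ℕ∞) : WithBot ℕ∞) ≤ deltaCirc G B := by
  -- A general `q` carries the surjection over to the type `ZMod (p ^ 1)`, where all `α_j` are `1`.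
  have h1 : ∀ q, q = p → ∃ π : G →+ (Fin (r + 1) → ZMod q), Function.Surjective π := by
    rintro q rfl
    exact exists_surjective_pi_zmod hp hk r h
  obtain ⟨π, hπ⟩ := h1 (p ^ 1) (pow_one p)
  have h2 := primaryDegree_le_deltaCirc hp (α := fun _ => 1) antitone_const le_rfl hπ hβ hb
  have h3 : primaryDegree p r (fun _ => 1) β = (r + β) * (p - 1) := by
    obtain ⟨i, rfl⟩ : ∃ i, β = i + 1 := ⟨β - 1, by omega⟩
    simp [primaryDegree]
    ring
  rwa [h3] at h2

end PrimaryGroups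

/-! ### Assembly of the theorem -/

section Main

open AddCommGroup

theorem primaryComponent_exists_pow_nsmul_eq_zero {A : Type*} [AddCommGroup A] {p : ℕ}
    (x : primaryComponent A p) : ∃ k : ℕ, p ^ k • x = 0 := by
  obtain ⟨k, hk⟩ := x.2
  exact ⟨k, Subtype.ext (by simpa using hk)⟩

theorem eq_top_of_forall_natCast_le {d : WithBot ℕ∞}
    (h : ∀ n : ℕ, ∃ m : ℕ, n ≤ m ∧ ((m : ℕ∞) : WithBot ℕ∞) ≤ d) : d = ⊤ := by
  rcases withBot_enat_cases d with rfl | ⟨n, rfl⟩ | rfl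
  · obtain ⟨m, -, hm⟩ := h 0
    exact absurd (le_bot_iff.1 hm) WithBot.coe_ne_bot
  · obtain ⟨m, hnm, hm⟩ := h (n + 1)
    have : m ≤ n := by exact_mod_cast hm
    omega
  · rfl

theorem exists_lt_addOrderOf_eq_prime_pow {B : Type*} [AddCommGroup B] {p : ℕ}
    (hp : p.Prime) (hB : ∀ b : B, ∃ k : ℕ, p ^ k • b = 0) {n : ℕ} (h : ∃ b : B, p ^ n • b ≠ 0) :
    ∃ β, n < β ∧ ∃ b : B, addOrderOf b = p ^ β := by
  obtain ⟨b, hb⟩ := h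
  obtain ⟨k, hk⟩ := hB b
  obtain ⟨β, -, hβ⟩ := (Nat.dvd_prime_pow hp).1 (addOrderOf_dvd_of_nsmul_eq_zero hk)
  refine ⟨β, ?_, b, hβ⟩
  by_contra hle
  exact hb (addOrderOf_dvd_iff_nsmul_eq_zero.1 (hβ ▸ pow_dvd_pow p (not_lt.1 hle)))

theorem theorem3p10 (A B : Type*) [AddCommGroup A] [AddCommGroup B] [Nontrivial A] [Nontrivial B]
    (hA : IsAddTorsion A) (hB : IsAddTorsion B)
    (hexp : ∀ p : Nat.Primes, AddMonoid.ExponentExists (AddCommGroup.primaryComponent A p)) :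
    -- (a) reduction to the primary components
    (deltaCirc A B =
      ⨆ p : Nat.Primes, deltaCirc (AddCommGroup.primaryComponent A p) (AddCommGroup.primaryComponent B p)) ∧
    -- (b) infinitely many common primes
    ({p : Nat.Primes | AddCommGroup.primaryComponent A p ≠ ⊥ ∧ AddCommGroup.primaryComponent B p ≠ ⊥}.Infinite → deltaCirc A B = ⊤) ∧
    -- (c) a primary component of `B` of infinite exponent
    ((∃ p : Nat.Primes, AddCommGroup.primaryComponent A p ≠ ⊥ ∧ ¬ AddMonoid.ExponentExists (AddCommGroup.primaryComponent B p)) →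
      deltaCirc A B = ⊤) ∧
    -- (d) an infinite primary component of `A`
    ((∃ p : Nat.Primes, Infinite (AddCommGroup.primaryComponent A p) ∧ AddCommGroup.primaryComponent B p ≠ ⊥) → deltaCirc A B = ⊤) ∧
    -- (e) the remaining case, `S` being the finite set of common primes
    (∀ S : Finset Nat.Primes, (∀ p, p ∈ S ↔ AddCommGroup.primaryComponent A p ≠ ⊥ ∧ AddCommGroup.primaryComponent B p ≠ ⊥) →
      (∀ p ∈ S, Finite (AddCommGroup.primaryComponent A p) ∧ AddMonoid.ExponentExists (AddCommGroup.primaryComponent B p)) →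
      deltaCirc A B < ⊤ ∧
      (∀ p ∈ S, ∃ (r : ℕ) (α : Fin (r + 1) → ℕ) (β : ℕ),
        HasPrimaryType (AddCommGroup.primaryComponent A p) (AddCommGroup.primaryComponent B p) p r α β) ∧
      ∀ (r : Nat.Primes → ℕ) (α : (p : Nat.Primes) → Fin (r p + 1) → ℕ) (β : Nat.Primes → ℕ),
        (∀ p ∈ S, HasPrimaryType (AddCommGroup.primaryComponent A p) (AddCommGroup.primaryComponent B p) p (r p) (α p) (β p)) →
        (∀ p ∈ S, deltaCirc (AddCommGroup.primaryComponent A p) (AddCommGroup.primaryComponent B p) =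
          ((primaryDegree p (r p) (α p) (β p) : ℕ∞) : WithBot ℕ∞)) ∧
        deltaCirc A B =
          ((S.sup fun p => primaryDegree p (r p) (α p) (β p) : ℕ) : ℕ∞)) := by
  have ha := deltaCirc_eq_iSup_primaryComponent hA hB
  have hle : ∀ p : Nat.Primes,
      deltaCirc (primaryComponent A p) (primaryComponent B p) ≤ deltaCirc A B := fun p => by
    rw [ha]
    exact le_iSup (fun p : Nat.Primes =>
      deltaCirc (primaryComponent A p) (primaryComponent B p)) p
  have hkA : ∀ p : Nat.Primes, ∃ k : ℕ, ∀ g : primaryComponent A (p : ℕ), (p : ℕ) ^ k • g = 0 := by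
    intro p
    obtain ⟨k, hk⟩ :=
      exponent_eq_prime_pow p.2 primaryComponent_exists_pow_nsmul_eq_zero (hexp p)
    exact ⟨k, fun g => hk ▸ AddMonoid.exponent_nsmul_eq_zero g⟩
  have hb1 : ∀ p : Nat.Primes, primaryComponent B (p : ℕ) ≠ ⊥ →
      ∃ β, 0 < β ∧ ∃ b : primaryComponent B (p : ℕ), addOrderOf b = (p : ℕ) ^ β := by
    intro p hp
    have := (AddSubgroup.nontrivial_iff_ne_bot _).2 hp
    obtain ⟨b, hb⟩ := exists_ne (0 : primaryComponent B (p : ℕ))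
    exact exists_lt_addOrderOf_eq_prime_pow p.2
      primaryComponent_exists_pow_nsmul_eq_zero ⟨b, by simpa using hb⟩
  have hpt : ∀ p : Nat.Primes, primaryComponent A (p : ℕ) ≠ ⊥ →
      primaryComponent B (p : ℕ) ≠ ⊥ →
      ∀ {r : ℕ} {α : Fin (r + 1) → ℕ} {β : ℕ},
        HasPrimaryType (primaryComponent A (p : ℕ)) (primaryComponent B (p : ℕ)) p r α β →
        deltaCirc (primaryComponent A p) (primaryComponent B p)
          = ((primaryDegree p r α β : ℕ∞) : WithBot ℕ∞) := by
    intro p hAp hBp r α β h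
    have := (AddSubgroup.nontrivial_iff_ne_bot _).2 hAp
    have := (AddSubgroup.nontrivial_iff_ne_bot _).2 hBp
    exact h.deltaCirc_eq p.2
  refine ⟨ha, fun hinf => ?_, ?_, ?_, fun S hS hSfin => ?_⟩
  · refine eq_top_of_forall_natCast_le fun n => ?_
    have hfin : {p : Nat.Primes | (p : ℕ) ≤ n + 1}.Finite :=
      Set.Finite.preimage Subtype.val_injective.injOn (Set.finite_Iic (n + 1))
    obtain ⟨p, ⟨hAp, hBp⟩, hpn⟩ := hinf.exists_notMem_finite hfin
    have hpn : n + 1 < (p : ℕ) := not_le.1 hpn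
    have := (AddSubgroup.nontrivial_iff_ne_bot _).2 hAp
    obtain ⟨k, hk⟩ := hkA p
    obtain ⟨β, hβ, b, hb⟩ := hb1 p hBp
    refine ⟨_, ?_, (mul_le_deltaCirc p.2 hk (r := 0) (Or.inr ⟨rfl, this⟩) hβ hb).trans (hle p)⟩
    have := Nat.mul_le_mul_right ((p : ℕ) - 1) hβ
    rw [zero_add]
    omega
  · rintro ⟨p, hAp, hBp⟩
    refine eq_top_of_forall_natCast_le fun n => ?_
    have := (AddSubgroup.nontrivial_iff_ne_bot _).2 hAp
    obtain ⟨k, hk⟩ := hkA p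
    obtain ⟨β, hβ, b, hb⟩ := exists_lt_addOrderOf_eq_prime_pow (n := n) p.2
      -- Otherwise `p^n` would kill the whole component, giving it finite exponent.
      (primaryComponent_exists_pow_nsmul_eq_zero (A := B)) (by
        by_contra! h
        exact hBp ⟨(p : ℕ) ^ n, pow_pos p.2.pos n, h⟩)
    refine ⟨_, ?_, (mul_le_deltaCirc p.2 hk (r := 0) (Or.inr ⟨rfl, this⟩) (by omega) hb).trans
      (hle p)⟩
    have h1 : 1 ≤ (p : ℕ) - 1 := by have := p.2.two_le; omega
    have := Nat.mul_le_mul_left β h1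
    rw [zero_add]
    omega
  · rintro ⟨p, hAp, hBp⟩
    refine eq_top_of_forall_natCast_le fun n => ?_
    obtain ⟨k, hk⟩ := hkA p
    obtain ⟨β, hβ, b, hb⟩ := hb1 p hBp
    refine ⟨_, ?_, (mul_le_deltaCirc p.2 hk (r := n) (Or.inl hAp) hβ hb).trans (hle p)⟩
    have h1 : 1 ≤ (p : ℕ) - 1 := by have := p.2.two_le; omega
    have := Nat.mul_le_mul_left (n + β) h1
    omega
  · have hex : ∀ p ∈ S, ∃ (r : ℕ) (α : Fin (r + 1) → ℕ) (β : ℕ),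
        HasPrimaryType (primaryComponent A (p : ℕ)) (primaryComponent B (p : ℕ)) p r α β := by
      intro p hp
      have := (AddSubgroup.nontrivial_iff_ne_bot _).2 ((hS p).1 hp).1
      have := (hSfin p hp).1
      obtain ⟨r, α, hα, he⟩ := exists_addEquiv_pi_zmod_prime_pow p.2
        (primaryComponent_exists_pow_nsmul_eq_zero (A := A))
      obtain ⟨β, hβ⟩ := exponent_eq_prime_pow p.2
        (primaryComponent_exists_pow_nsmul_eq_zero (A := B)) (hSfin p hp).2
      exact ⟨r, α, β, hα, he, hβ⟩
    have hform : ∀ (r : Nat.Primes → ℕ) (α : (p : Nat.Primes) → Fin (r p + 1) → ℕ)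
        (β : Nat.Primes → ℕ),
        (∀ p ∈ S, HasPrimaryType (primaryComponent A p) (primaryComponent B p) p
          (r p) (α p) (β p)) →
        (∀ p ∈ S, deltaCirc (primaryComponent A (p : ℕ)) (primaryComponent B (p : ℕ)) =
          ((primaryDegree p (r p) (α p) (β p) : ℕ∞) : WithBot ℕ∞)) ∧
        deltaCirc A B =
          ((S.sup fun p => primaryDegree p (r p) (α p) (β p) : ℕ) : ℕ∞) := by
      intro r α β h
      have h1 := fun p hp => hpt p ((hS p).1 hp).1 ((hS p).1 hp).2 (h p hp)
      refine ⟨h1, le_antisymm ?_ ?_⟩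
      · rw [ha]
        refine iSup_le fun p => ?_
        by_cases hp : p ∈ S
        · rw [h1 p hp, WithBot.coe_le_coe, Nat.cast_le]
          exact Finset.le_sup (f := fun p : Nat.Primes => primaryDegree p (r p) (α p) (β p)) hp
        -- Outside `S` one component is zero, so only constant maps or only the zero map occur.
        · have h0 : deltaCirc (primaryComponent A (p : ℕ)) (primaryComponent B (p : ℕ)) ≤ 0 := by
            by_cases hAp : primaryComponent A (p : ℕ) = ⊥
            · have := not_nontrivial_iff_subsingleton.1
                (mt (AddSubgroup.nontrivial_iff_ne_bot _).1 (not_not.2 hAp))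
              exact deltaCirc_le_zero_of_subsingleton
            · have hBp : primaryComponent B (p : ℕ) = ⊥ := by
                by_contra hBp
                exact hp ((hS p).2 ⟨hAp, hBp⟩)
              have := not_nontrivial_iff_subsingleton.1
                (mt (AddSubgroup.nontrivial_iff_ne_bot _).1 (not_not.2 hBp))
              rw [deltaCirc_eq_bot_of_subsingleton]
              exact bot_le
          exact h0.trans (WithBot.coe_le_coe.2 zero_le)
      · rcases S.eq_empty_or_nonempty with rfl | hne
        -- For empty `S` the value `0` is attained by nonzero constants.
        · simpa using zero_le_deltaCirc (A := A) (B := B)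
        · obtain ⟨p, hp, hpe⟩ := S.exists_mem_eq_sup hne
            fun p : Nat.Primes => primaryDegree p (r p) (α p) (β p)
          rw [hpe, ← h1 p hp]
          exact hle p
    refine ⟨?_, hex, hform⟩
    choose! r α β h using hex
    rw [(hform r α β h).2]
    exact WithBot.coe_lt_coe.2 (ENat.natCast_lt_top _)

end Main
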